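/- Let $I\subseteq\mathbb R$ be an interval (bounded or not) and let $\rho\ge 0$ be a probability density on $I$, continuous on the interior of $I$, with finite moments $c_n=\int_I t^n\rho(t)\,dt$ of every order, and such that the polynomials are dense in the real Hilbert space $L^2(I,\rho)$. Let $S_\rho(z)=\int_I\frac{\rho(t)\,dt}{z-t}$ denote the Stieltjes transform of $\rho$, and suppose that $\rho$ has a secondary measure with a density: a nonnegative function $\mu$ on $I$ with finite moments of every order whose Stieltjes transform satisfies $$S_\mu(z)=z-c_1-\frac1{S_\rho(z)}\qquad (z\in\mathbb C\setminus \overline I).$$ Suppose that for almost every $x\in I$ the limit $$\varphi(x)=\lim_{\varepsilon\to0^+}2\int_I\frac{(x-t)\rho(t)}{(x-t)^2+\varepsilon^2}\,dt$$ exists in $\mathbb R$; the function $\varphi$ is called the reducer of $\rho$. Let $T_\rho:L^2(I,\rho)\to L^2(I,\mu)$ be the continuous linear extension of the operator which sends a polynomial $p$ to its secondary polynomial $x\mapsto\int_I\frac{p(t)-p(x)}{t-x}\rho(t)\,dt$, and let $H_\rho=\{f\in L^2(I,\rho):\int_I f\rho\,dx=0\}$ be the hyperplane orthogonal to the constant $1$.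 The measure of density $\rho$ is called reducible if $\varphi\in L^2(I,\rho)$, the functions $x\mapsto 2\int_I\frac{(x-t)\rho(t)}{(x-t)^2+\varepsilon^2}\,dt$ converge to $\varphi$ in the norm of $L^2(I,\rho)$ as $\varepsilon\to0^+$, and the quotient $\rho/\mu$ (as an element of $L^2(I,\mu)$) lies in the image of $T_\rho$. **Theorem.** If $\rho$ is reducible, then $T_\rho$ is well defined (the operator on polynomials does extend to a continuous linear map $L^2(I,\rho)\to L^2(I,\mu)$), $\rho/\mu$ has exactly one antecedent under $T_\rho$ in the hyperplane $H_\rho$, and this antecedent is the reducer: $\varphi\in H_\rho$ and $T_\rho(\varphi)=\rho/\mu$. -/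

import Mathlib

open MeasureTheory Filter Topology Polynomial

noncomputable section

namespace SecondaryMeasure

/-- The measure `w(x) dx` on `I`. -/
def densityMeasure (I : Set ℝ) (w : ℝ → ℝ) : Measure ℝ :=
  (volume.restrict I).withDensity (fun x => ENNReal.ofReal (w x))

/-- `w` is (almost everywhere) nonnegative on `I` and has finite moments of every order
(order `0` included, so `w` is integrable on `I`). -/
structure IsMomentDensity (I : Set ℝ) (w : ℝ → ℝ) : Prop where
  nonneg : ∀ᵐ x ∂(volume.restrict I), 0 ≤ w x
  integrableOn_pow : ∀ n : ℕ, IntegrableOn (fun x => x ^ n * w x) I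

/-- The moment `c_n = ∫_I t ^ n w(t) dt`. -/
def moment (I : Set ℝ) (w : ℝ → ℝ) (n : ℕ) : ℝ := ∫ t in I, t ^ n * w t

/-- The Stieltjes transform `S_w(z) = ∫_I w(t) / (z - t) dt`. -/
def stieltjes (I : Set ℝ) (w : ℝ → ℝ) (z : ℂ) : ℂ := ∫ t in I, (w t : ℂ) / (z - (t : ℂ))

/-- `μ` is the density on `I` of a secondary measure of `ρ`: it is nonnegative, has moments of all
orders, and its Stieltjes transform is `S_μ(z) = z - c₁ - 1 / S_ρ(z)` off the interval. -/
structure IsSecondaryDensity (I : Set ℝ) (ρ μ : ℝ → ℝ) : Prop where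
  isMomentDensity : IsMomentDensity I μ
  stieltjes_eq : ∀ z : ℂ, z ∉ (fun x : ℝ => (x : ℂ)) '' closure I →
    stieltjes I μ z = z - (moment I ρ 1 : ℂ) - 1 / stieltjes I ρ z

/-- The function `x ↦ 2 ∫_I (x - t) ρ(t) / ((x - t)² + ε²) dt`. -/
def approxReducer (I : Set ℝ) (ρ : ℝ → ℝ) (ε x : ℝ) : ℝ :=
  2 * ∫ t in I, (x - t) * ρ t / ((x - t) ^ 2 + ε ^ 2)

/-- The reducer of `ρ`: the pointwise limit of `approxReducer I ρ ε x` as `ε → 0⁺`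
(meaningful at the points `x` where this limit exists). -/
def reducer (I : Set ℝ) (ρ : ℝ → ℝ) (x : ℝ) : ℝ :=
  limUnder (𝓝[>] (0 : ℝ)) (fun ε => approxReducer I ρ ε x)

/-- The function `x ↦ ∫_I (p(t) - p(x)) / (t - x) ρ(t) dt`. -/
def secondaryFun (I : Set ℝ) (ρ : ℝ → ℝ) (p : ℝ[X]) (x : ℝ) : ℝ :=
  ∫ t in I, (p.eval t - p.eval x) / (t - x) * ρ t

variable {I : Set ℝ} {w ρ μ : ℝ → ℝ}

theorem IsMomentDensity.integrableOn_eval (h : IsMomentDensity I w) (p : ℝ[X]) :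
    IntegrableOn (fun x => p.eval x * w x) I := by
  induction p using Polynomial.induction_on' with
  | add p q hp hq =>
    refine (hp.add hq).congr (Eventually.of_forall fun x => ?_)
    simp [add_mul]
  | monomial n a =>
    refine ((h.integrableOn_pow n).const_mul a).congr (Eventually.of_forall fun x => ?_)
    simp [mul_assoc]

theorem IsMomentDensity.aemeasurable (h : IsMomentDensity I w) :
    AEMeasurable w (volume.restrict I) := by
  simpa using (h.integrableOn_pow 0).aemeasurable

/-- Polynomials are square-integrable for a measure with moments of all orders. -/
theorem IsMomentDensity.memLp_eval (h : IsMomentDensity I w) (p : ℝ[X]) :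
    MemLp (fun x => p.eval x) 2 (densityMeasure I w) := by
  rw [memLp_two_iff_integrable_sq p.continuous.aestronglyMeasurable, densityMeasure,
    integrable_withDensity_iff_integrable_smul₀' h.aemeasurable.ennreal_ofReal (by simp)]
  refine (h.integrableOn_eval (p ^ 2)).congr ?_
  filter_upwards [h.nonneg] with x hx
  simp [ENNReal.toReal_ofReal hx, mul_comm]

theorem ae_ne_restrict (I : Set ℝ) (x : ℝ) : ∀ᵐ t ∂(volume.restrict I), t ≠ x :=
  ae_restrict_of_ae (compl_mem_ae_iff.mpr (measure_singleton x))

theorem IsMomentDensity.integrableOn_secondary (h : IsMomentDensity I ρ) (p : ℝ[X]) (x : ℝ) :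
    IntegrableOn (fun t => (p.eval t - p.eval x) / (t - x) * ρ t) I := by
  obtain ⟨s, hs⟩ := Polynomial.X_sub_C_dvd_sub_C_eval (a := x) (p := p)
  refine (h.integrableOn_eval s).congr ?_
  filter_upwards [ae_ne_restrict I x] with t ht
  have h1 := congrArg (Polynomial.eval t) hs
  simp only [eval_sub, eval_C, eval_mul, eval_X] at h1
  rw [h1, mul_div_cancel_left₀ _ (sub_ne_zero.mpr ht)]

theorem IsMomentDensity.secondaryFun_add (h : IsMomentDensity I ρ) (p q : ℝ[X]) (x : ℝ) :
    secondaryFun I ρ (p + q) x = secondaryFun I ρ p x + secondaryFun I ρ q x := by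
  unfold secondaryFun
  rw [← integral_add (h.integrableOn_secondary p x) (h.integrableOn_secondary q x)]
  congr 1
  ext t
  simp only [eval_add]
  ring

theorem secondaryFun_smul (a : ℝ) (p : ℝ[X]) (x : ℝ) :
    secondaryFun I ρ (a • p) x = a * secondaryFun I ρ p x := by
  unfold secondaryFun
  rw [← integral_const_mul]
  congr 1
  ext t
  simp only [eval_smul, smul_eq_mul]
  ring

/-- The function `secondaryFun I ρ p` is a polynomial function (the secondary polynomial of `p`). -/
theorem IsMomentDensity.exists_secondaryFun_eq_eval (h : IsMomentDensity I ρ) (p : ℝ[X]) :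
    ∃ q : ℝ[X], ∀ x, secondaryFun I ρ p x = q.eval x := by
  induction p using Polynomial.induction_on' with
  | add p q hp hq =>
    obtain ⟨p', hp'⟩ := hp
    obtain ⟨q', hq'⟩ := hq
    exact ⟨p' + q', fun x => by rw [h.secondaryFun_add, hp', hq', eval_add]⟩
  | monomial n a =>
    refine ⟨∑ k ∈ Finset.range n, C (a * moment I ρ k) * X ^ (n - 1 - k), fun x => ?_⟩
    have h1 : secondaryFun I ρ (monomial n a) x =
        ∫ t in I, ∑ k ∈ Finset.range n, a * x ^ (n - 1 - k) * (t ^ k * ρ t) := by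
      unfold secondaryFun
      refine integral_congr_ae ?_
      filter_upwards [ae_ne_restrict I x] with t ht
      have h2 := geom_sum₂_mul t x n
      simp only [eval_monomial]
      rw [← mul_sub, ← h2, ← mul_assoc, mul_div_cancel_right₀ _ (sub_ne_zero.mpr ht),
        Finset.mul_sum, Finset.sum_mul]
      exact Finset.sum_congr rfl fun k _ => by ring
    rw [h1, integral_finsetSum _ fun k _ => (h.integrableOn_pow k).const_mul _]
    simp only [integral_const_mul, eval_finsetSum, eval_mul, eval_C, eval_pow, eval_X, moment]
    exact Finset.sum_congr rfl fun k _ => by ring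

theorem memLp_secondaryFun (hρ : IsMomentDensity I ρ) (hμ : IsMomentDensity I μ) (p : ℝ[X]) :
    MemLp (secondaryFun I ρ p) 2 (densityMeasure I μ) := by
  obtain ⟨q, hq⟩ := hρ.exists_secondaryFun_eq_eval p
  rw [show secondaryFun I ρ p = fun x => q.eval x from funext hq]
  exact hμ.memLp_eval q

/-- The class in `L²(I, w)` of a polynomial. -/
def polyToL2 (h : IsMomentDensity I w) : ℝ[X] →ₗ[ℝ] Lp ℝ 2 (densityMeasure I w) where
  toFun p := (h.memLp_eval p).toLp (fun x => p.eval x)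
  map_add' p q := by
    rw [← MemLp.toLp_add]
    exact MemLp.toLp_congr _ _ (Eventually.of_forall fun x => by simp)
  map_smul' a p := by
    rw [RingHom.id_apply, ← MemLp.toLp_const_smul]
    exact MemLp.toLp_congr _ _ (Eventually.of_forall fun x => by simp)

/-- The operator creating secondary polynomials, from polynomials to `L²(I, μ)`. -/
def secondaryToL2 (hρ : IsMomentDensity I ρ) (hμ : IsMomentDensity I μ) :
    ℝ[X] →ₗ[ℝ] Lp ℝ 2 (densityMeasure I μ) where
  toFun p := (memLp_secondaryFun hρ hμ p).toLp (secondaryFun I ρ p)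
  map_add' p q := by
    rw [← MemLp.toLp_add]
    exact MemLp.toLp_congr _ _ (Eventually.of_forall fun x => hρ.secondaryFun_add p q x)
  map_smul' a p := by
    rw [RingHom.id_apply, ← MemLp.toLp_const_smul]
    exact MemLp.toLp_congr _ _ (Eventually.of_forall fun x => by
      simp [secondaryFun_smul])

/-- The operator `T_ρ : L²(I, ρ) → L²(I, μ)`: the continuous linear extension of the operator
creating secondary polynomials (it extends it as soon as the polynomials are dense in `L²(I, ρ)`
and that operator is bounded for the two norms). -/
def secondaryOperator (hρ : IsMomentDensity I ρ) (hμ : IsMomentDensity I μ) :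
    Lp ℝ 2 (densityMeasure I ρ) →L[ℝ] Lp ℝ 2 (densityMeasure I μ) :=
  (secondaryToL2 hρ hμ).extendOfNorm (polyToL2 hρ)

/-- The hyperplane `H_ρ` of `L²(I, ρ)`: the orthogonal complement of the constant `P₀ = 1`. -/
def hyperplane (hρ : IsMomentDensity I ρ) : Submodule ℝ (Lp ℝ 2 (densityMeasure I ρ)) :=
  (Submodule.span ℝ {polyToL2 hρ 1})ᗮ

/-- `f` is an antecedent under `T_ρ` of the quotient `ρ / μ`, as an element of `L²(I, μ)`. -/
def IsAntecedent (hρ : IsMomentDensity I ρ) (hμ : IsMomentDensity I μ)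
    (f : Lp ℝ 2 (densityMeasure I ρ)) : Prop :=
  secondaryOperator hρ hμ f =ᵐ[densityMeasure I μ] fun x => ρ x / μ x

/-- The measure of density `ρ`, with secondary density `μ`, is reducible: its reducer is the limit
of the functions `approxReducer I ρ ε` in `L²(I, ρ)`, and `ρ / μ` is in the image of `T_ρ`. -/
structure IsReducible (hρ : IsMomentDensity I ρ) (hμ : IsMomentDensity I μ) : Prop where
  memLp_reducer : MemLp (reducer I ρ) 2 (densityMeasure I ρ)
  tendsto_reducer : Tendsto
    (fun ε => eLpNorm (approxReducer I ρ ε - reducer I ρ) 2 (densityMeasure I ρ))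
    (𝓝[>] (0 : ℝ)) (𝓝 0)
  exists_antecedent : ∃ f, IsAntecedent hρ hμ f

/-- The reducer as an element of `L²(I, ρ)`. -/
def IsReducible.reducerL2 {hρ : IsMomentDensity I ρ} {hμ : IsMomentDensity I μ}
    (h : IsReducible hρ hμ) : Lp ℝ 2 (densityMeasure I ρ) :=
  h.memLp_reducer.toLp (reducer I ρ)

end SecondaryMeasure

end

noncomputable section

namespace SecondaryMeasure

variable {I : Set ℝ} {w ρ μ : ℝ → ℝ}

/-! ### Stieltjes transforms -/

/-! Write `Q_p` for the secondary polynomial of `p` and `φ` for the reducer. Two formulas carry the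
proof: (1) `⟨Q_p, Q_q⟩_μ = ⟨p, q⟩_ρ - ⟨p, 1⟩_ρ ⟨1, q⟩_ρ` (`integral_secondaryFun_mul_secondaryFun`);
(2) `⟨φ, p⟩_ρ = ∫ Q_p ρ` (`IsReducible.inner_reducerL2`).

By (1) the map `p ↦ Q_p` is bounded by 1; its extension `T` kills constants and is isometric on the
hyperplane, which gives uniqueness. If `T f = ρ/μ`, then `⟨T f, Q_p⟩_μ = ∫ Q_p ρ`, so (1) and (2)
give `f - ⟨1, f⟩ 1` and `φ` the same scalar product with every polynomial. By density they are
equal, and `T φ = T f = ρ/μ`.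

Formula (1) comes from the relation between `S_ρ` and `S_μ`, by induction on the degree and
asymptotics along `z = iy`, `y → ∞`. Formula (2) comes from symmetrizing a double integral with an
odd kernel and letting `ε → 0`.

Cancelling `μ` in `(ρ/μ) μ = ρ` requires `ρ = 0` almost everywhere on `{μ = 0}`. This is
`IsSecondaryDensity.ae_nonpos_of_nonpos`, read off from the imaginary parts of the Stieltjes
transforms near the real line. -/

theorem norm_div_sub_le (a t : ℝ) {z : ℂ} (hz : z.im ≠ 0) :
    ‖(a : ℂ) / (z - t)‖ ≤ |z.im|⁻¹ * |a| := by
  have h1 : |z.im| ≤ ‖z - t‖ := by simpa using Complex.abs_im_le_norm (z - t)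
  have h2 : 0 < |z.im| := abs_pos.mpr hz
  rw [norm_div, Complex.norm_real, Real.norm_eq_abs, div_eq_inv_mul]
  gcongr

theorem sub_ofReal_ne_zero {z : ℂ} (hz : z.im ≠ 0) (t : ℝ) : z - t ≠ 0 :=
  fun h => hz (by simpa using congrArg Complex.im h)

theorem aestronglyMeasurable_stieltjes (hw : IntegrableOn w I) (z : ℂ) :
    AEStronglyMeasurable (fun t => (w t : ℂ) / (z - (t : ℂ))) (volume.restrict I) :=
  AEStronglyMeasurable.div₀ (hw.ofReal (𝕜 := ℂ)).aestronglyMeasurable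
    (Continuous.aestronglyMeasurable (by fun_prop))

theorem integrableOn_stieltjes (hw : IntegrableOn w I) {z : ℂ} (hz : z.im ≠ 0) :
    IntegrableOn (fun t => (w t : ℂ) / (z - t)) I :=
  (hw.norm.const_mul |z.im|⁻¹).mono' (aestronglyMeasurable_stieltjes hw z)
    (Eventually.of_forall fun _ => norm_div_sub_le _ _ hz)

theorem stieltjes_add {v : ℝ → ℝ} (hv : IntegrableOn v I) (hw : IntegrableOn w I) {z : ℂ}
    (hz : z.im ≠ 0) :
    stieltjes I (fun t => v t + w t) z = stieltjes I v z + stieltjes I w z := by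
  unfold stieltjes
  rw [← integral_add (integrableOn_stieltjes hv hz) (integrableOn_stieltjes hw hz)]
  congr 1
  ext t
  push_cast
  ring

theorem stieltjes_const_mul (a : ℝ) (w : ℝ → ℝ) (z : ℂ) :
    stieltjes I (fun t => a * w t) z = a * stieltjes I w z := by
  unfold stieltjes
  rw [← integral_const_mul]
  congr 1
  ext t
  push_cast
  ring

theorem stieltjes_id_mul (hw : IntegrableOn w I) {z : ℂ} (hz : z.im ≠ 0) :
    stieltjes I (fun t => t * w t) z = z * stieltjes I w z - ((∫ t in I, w t : ℝ) : ℂ) := by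
  unfold stieltjes
  have h : IntegrableOn (fun t => (w t : ℂ)) I := hw.ofReal
  rw [← integral_complex_ofReal, ← integral_const_mul,
    ← integral_sub ((integrableOn_stieltjes hw hz).const_mul z) h]
  congr 1
  ext t
  have := sub_ofReal_ne_zero hz t
  simp only [Complex.ofReal_mul]
  field_simp
  ring

/-- Dominated convergence: `iy / (iy - t)` tends to 1 and has modulus at most 1. The total mass is
thus read off from the behaviour of the transform at infinity. -/
theorem tendsto_mul_stieltjes (hw : IntegrableOn w I) :
    Tendsto (fun y : ℝ => (y * Complex.I) * stieltjes I w (y * Complex.I)) atTop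
      (𝓝 ((∫ t in I, w t : ℝ) : ℂ)) := by
  simp only [stieltjes, ← integral_const_mul, ← integral_complex_ofReal]
  refine tendsto_integral_filter_of_dominated_convergence (fun t => ‖w t‖) ?_ ?_ hw.norm ?_
  · exact Eventually.of_forall fun y => (aestronglyMeasurable_stieltjes hw _).const_mul _
  · filter_upwards [eventually_gt_atTop 0] with y hy
    refine Eventually.of_forall fun t => ?_
    have h := norm_div_sub_le (w t) t (z := y * Complex.I) (by simpa using hy.ne')
    have hy' : ‖(y : ℂ) * Complex.I‖ = |y| := by simp
    rw [norm_mul, hy']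
    calc |y| * _ ≤ |y| * (|((y : ℂ) * Complex.I).im|⁻¹ * |w t|) := by gcongr
      _ = ‖w t‖ := by
        have : |y| ≠ 0 := abs_ne_zero.mpr hy.ne'
        simp [mul_inv_cancel_left₀ this]
  · refine Eventually.of_forall fun t => ?_
    have h0 : Tendsto (fun y : ℝ => (t : ℂ) * ((y : ℂ)⁻¹ * Complex.I)) atTop (𝓝 0) := by
      have h1 : Tendsto (fun y : ℝ => ((y⁻¹ : ℝ) : ℂ)) atTop (𝓝 ((0 : ℝ) : ℂ)) :=
        (Complex.continuous_ofReal.tendsto _).comp tendsto_inv_atTop_zero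
      simpa using (h1.mul_const Complex.I).const_mul (t : ℂ)
    have h1 : Tendsto (fun y : ℝ => (w t : ℂ) / (1 + (t : ℂ) * ((y : ℂ)⁻¹ * Complex.I))) atTop
        (𝓝 ((w t : ℂ) / (1 + 0))) :=
      tendsto_const_nhds.div (h0.const_add 1) (by simp)
    rw [add_zero, div_one] at h1
    refine h1.congr' ?_
    filter_upwards [eventually_gt_atTop 0] with y hy
    have hy0 : (y : ℂ) ≠ 0 := by exact_mod_cast hy.ne'
    have hz : (y : ℂ) * Complex.I - t ≠ 0 := sub_ofReal_ne_zero (by simpa using hy.ne') t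
    have he : (y : ℂ) * Complex.I * (1 + (t : ℂ) * ((y : ℂ)⁻¹ * Complex.I)) =
        y * Complex.I - t := by
      field_simp
      linear_combination (t : ℂ) * Complex.I_sq
    rw [← he] at hz ⊢
    have h2 := right_ne_zero_of_mul hz
    have h3 := left_ne_zero_of_mul hz
    rw [← mul_div_assoc, mul_div_mul_left _ _ h3]

theorem tendsto_stieltjes (hw : IntegrableOn w I) :
    Tendsto (fun y : ℝ => stieltjes I w (y * Complex.I)) atTop (𝓝 0) := by
  have h1 : Tendsto (fun y : ℝ => ((y⁻¹ : ℝ) : ℂ)) atTop (𝓝 ((0 : ℝ) : ℂ)) :=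
    (Complex.continuous_ofReal.tendsto _).comp tendsto_inv_atTop_zero
  have h2 := ((h1.mul_const (-Complex.I)).mul (tendsto_mul_stieltjes hw))
  simp only [Complex.ofReal_zero, zero_mul] at h2
  refine h2.congr' ?_
  filter_upwards [eventually_gt_atTop 0] with y hy
  have hy0 : (y : ℂ) ≠ 0 := by exact_mod_cast hy.ne'
  push_cast
  field_simp
  linear_combination (-stieltjes I w (y * Complex.I)) * Complex.I_sq

/-! ### Secondary polynomials -/

theorem IsMomentDensity.integrableOn_self (h : IsMomentDensity I w) : IntegrableOn w I := by
  simpa using h.integrableOn_pow 0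

theorem secondaryFun_C (a x : ℝ) : secondaryFun I ρ (C a) x = 0 := by
  simp [secondaryFun]

theorem IsMomentDensity.secondaryFun_X_mul (h : IsMomentDensity I ρ) (p : ℝ[X]) (x : ℝ) :
    secondaryFun I ρ (X * p) x = x * secondaryFun I ρ p x + ∫ t in I, p.eval t * ρ t := by
  unfold secondaryFun
  rw [← integral_const_mul,
    ← integral_add ((h.integrableOn_secondary p x).const_mul x) (h.integrableOn_eval p)]
  refine integral_congr_ae ?_
  filter_upwards [ae_ne_restrict I x] with t ht
  have := sub_ne_zero.mpr ht
  simp only [eval_mul, eval_X]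
  field_simp
  ring

theorem integrableOn_secondaryFun_mul (hρ : IsMomentDensity I ρ) (hμ : IsMomentDensity I μ)
    (p q : ℝ[X]) : IntegrableOn (fun x => q.eval x * secondaryFun I ρ p x * μ x) I := by
  obtain ⟨r, hr⟩ := hρ.exists_secondaryFun_eq_eval p
  simpa [hr] using hμ.integrableOn_eval (q * r)

theorem integrableOn_secondaryFun (hρ : IsMomentDensity I ρ) (hμ : IsMomentDensity I μ)
    (p : ℝ[X]) : IntegrableOn (fun x => secondaryFun I ρ p x * μ x) I := by
  simpa using integrableOn_secondaryFun_mul hρ hμ p 1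

theorem integrableOn_secondaryFun_mul_secondaryFun (hρ : IsMomentDensity I ρ)
    (hμ : IsMomentDensity I μ) (p q : ℝ[X]) :
    IntegrableOn (fun x => secondaryFun I ρ p x * secondaryFun I ρ q x * μ x) I := by
  obtain ⟨r, hr⟩ := hρ.exists_secondaryFun_eq_eval p
  simpa [hr] using integrableOn_secondaryFun_mul hρ hμ q r

theorem ofReal_mul_I_notMem {y : ℝ} (hy : y ≠ 0) (s : Set ℝ) :
    (y : ℂ) * Complex.I ∉ (fun x : ℝ => (x : ℂ)) '' s := by
  rintro ⟨x, -, hx⟩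
  exact hy (by simpa using (congrArg Complex.im hx).symm)

/-- The defect in the identity expressing that `p ↦ secondaryFun I ρ p` preserves scalar products
with the functions `x ↦ 1 / (z - x)`. -/
def resolventDefect (I : Set ℝ) (ρ μ : ℝ → ℝ) (p : ℝ[X]) (z : ℂ) : ℂ :=
  stieltjes I ρ z * stieltjes I (fun x => secondaryFun I ρ p x * μ x) z
    - stieltjes I (fun x => p.eval x * ρ x) z
    + ((∫ t in I, p.eval t * ρ t : ℝ) : ℂ) * stieltjes I ρ z

theorem resolventDefect_C (a : ℝ) (z : ℂ) (hρ1 : ∫ x in I, ρ x = 1) :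
    resolventDefect I ρ μ (C a) z = 0 := by
  simp only [resolventDefect, secondaryFun_C, eval_C, stieltjes_const_mul, integral_const_mul, hρ1]
  simp [stieltjes]

theorem resolventDefect_add (hρ : IsMomentDensity I ρ) (hμ : IsMomentDensity I μ) (p q : ℝ[X])
    {z : ℂ} (hz : z.im ≠ 0) : resolventDefect I ρ μ (p + q) z =
      resolventDefect I ρ μ p z + resolventDefect I ρ μ q z := by
  simp only [resolventDefect, hρ.secondaryFun_add, eval_add, add_mul]
  rw [stieltjes_add (integrableOn_secondaryFun hρ hμ p) (integrableOn_secondaryFun hρ hμ q) hz,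
    stieltjes_add (hρ.integrableOn_eval p) (hρ.integrableOn_eval q) hz,
    integral_add (hρ.integrableOn_eval p) (hρ.integrableOn_eval q)]
  push_cast
  ring

theorem stieltjes_X_mul (h : IsMomentDensity I w) (p : ℝ[X]) {z : ℂ} (hz : z.im ≠ 0) :
    stieltjes I (fun x => (X * p).eval x * w x) z =
      z * stieltjes I (fun x => p.eval x * w x) z - ((∫ t in I, p.eval t * w t : ℝ) : ℂ) := by
  rw [← stieltjes_id_mul (h.integrableOn_eval p) hz]
  simp [mul_assoc]

theorem stieltjes_secondaryFun_X_mul (hρ : IsMomentDensity I ρ) (hμ : IsMomentDensity I μ)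
    (p : ℝ[X]) {z : ℂ} (hz : z.im ≠ 0) :
    stieltjes I (fun x => secondaryFun I ρ (X * p) x * μ x) z =
      z * stieltjes I (fun x => secondaryFun I ρ p x * μ x) z
        - ((∫ x in I, secondaryFun I ρ p x * μ x : ℝ) : ℂ)
        + ((∫ t in I, p.eval t * ρ t : ℝ) : ℂ) * stieltjes I μ z := by
  have h1 := integrableOn_secondaryFun hρ hμ p
  have h2 : IntegrableOn (fun x => x * (secondaryFun I ρ p x * μ x)) I := by
    simpa [mul_assoc] using integrableOn_secondaryFun_mul hρ hμ p X
  rw [← stieltjes_id_mul h1 hz, ← stieltjes_const_mul,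
    ← stieltjes_add h2 (hμ.integrableOn_self.const_mul _) hz]
  simp only [hρ.secondaryFun_X_mul, add_mul, mul_assoc]

/-- The defect in the identity `∫ Q_p μ = ∫ t p ρ - c₁ ∫ p ρ`, where `Q_p = secondaryFun I ρ p`. -/
def momentDefect (I : Set ℝ) (ρ μ : ℝ → ℝ) (p : ℝ[X]) : ℝ :=
  (∫ t in I, (X * p).eval t * ρ t) - moment I ρ 1 * (∫ t in I, p.eval t * ρ t)
    - ∫ x in I, secondaryFun I ρ p x * μ x

/-- Multiplying `p` by `X` brings in the product `S_ρ S_μ`, which the secondary relation turns into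
`(z - c₁) S_ρ - 1`. Since `1 / 0 = 0`, that step needs `S_ρ ≠ 0`. -/
theorem resolventDefect_X_mul (hρ : IsMomentDensity I ρ) (hμ : IsSecondaryDensity I ρ μ)
    (p : ℝ[X]) {y : ℝ} (hy : y ≠ 0) (hS : stieltjes I ρ (y * Complex.I) ≠ 0) :
    resolventDefect I ρ μ (X * p) (y * Complex.I) =
      y * Complex.I * resolventDefect I ρ μ p (y * Complex.I)
        + momentDefect I ρ μ p * stieltjes I ρ (y * Complex.I) := by
  have hz : ((y : ℂ) * Complex.I).im ≠ 0 := by simpa using hy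
  have h1 : stieltjes I ρ (y * Complex.I) * stieltjes I μ (y * Complex.I) =
      (y * Complex.I - moment I ρ 1) * stieltjes I ρ (y * Complex.I) - 1 := by
    rw [hμ.stieltjes_eq _ (ofReal_mul_I_notMem hy _)]
    field_simp
  simp only [resolventDefect, momentDefect, stieltjes_X_mul hρ p hz,
    stieltjes_secondaryFun_X_mul hρ hμ.isMomentDensity p hz]
  push_cast
  linear_combination ((∫ t in I, p.eval t * ρ t : ℝ) : ℂ) * h1

/-- As `z S_ρ → 1`, the first term of the defect contributes 0 in the limit, and the other two
contribute `-∫ p ρ` and `+∫ p ρ`. -/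
theorem tendsto_mul_resolventDefect (hρ : IsMomentDensity I ρ) (hμ : IsMomentDensity I μ)
    (hρ1 : ∫ x in I, ρ x = 1) (p : ℝ[X]) :
    Tendsto (fun y : ℝ => y * Complex.I * resolventDefect I ρ μ p (y * Complex.I)) atTop
      (𝓝 0) := by
  have h1 := tendsto_mul_stieltjes hρ.integrableOn_self
  have h2 := tendsto_stieltjes (integrableOn_secondaryFun hρ hμ p)
  have h3 := tendsto_mul_stieltjes (hρ.integrableOn_eval p)
  have h4 := ((h1.mul h2).sub h3).add (h1.const_mul ((∫ t in I, p.eval t * ρ t : ℝ) : ℂ))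
  rw [hρ1] at h4
  simp only [Complex.ofReal_one, mul_zero, mul_one, zero_sub, neg_add_cancel] at h4
  refine h4.congr fun y => ?_
  simp only [resolventDefect]
  ring

theorem eventually_stieltjes_ne_zero (hρ : IsMomentDensity I ρ) (hρ1 : ∫ x in I, ρ x = 1) :
    ∀ᶠ y : ℝ in atTop, stieltjes I ρ (y * Complex.I) ≠ 0 := by
  have h1 := tendsto_mul_stieltjes hρ.integrableOn_self
  rw [hρ1] at h1
  filter_upwards [h1.eventually_ne (by simp : ((1 : ℝ) : ℂ) ≠ 0)] with y hy
  exact right_ne_zero_of_mul hy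

/-- If the defect of `p` vanishes, that of `X * p` is the moment defect times `S_ρ`. Multiplied by
`z`, it tends both to the moment defect and to 0. -/
theorem momentDefect_eq_zero_of_resolventDefect (hρ : IsMomentDensity I ρ)
    (hμ : IsSecondaryDensity I ρ μ) (hρ1 : ∫ x in I, ρ x = 1) {p : ℝ[X]}
    (h : ∀ᶠ y : ℝ in atTop, resolventDefect I ρ μ p (y * Complex.I) = 0) :
    momentDefect I ρ μ p = 0 := by
  have h1 := (tendsto_mul_stieltjes hρ.integrableOn_self).const_mul (momentDefect I ρ μ p : ℂ)
  rw [hρ1, Complex.ofReal_one, mul_one] at h1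
  have h2 := tendsto_mul_resolventDefect hρ hμ.isMomentDensity hρ1 (X * p)
  have h3 := tendsto_nhds_unique (h1.congr' ?_) h2
  · exact_mod_cast h3
  · filter_upwards [h, eventually_gt_atTop 0, eventually_stieltjes_ne_zero hρ hρ1] with y h hy hS
    rw [resolventDefect_X_mul hρ hμ p hy.ne' hS, h]
    ring

/-- Vanishing for `p` forces the moment defect of `p` to vanish, and the recursion then gives
vanishing for `X * p`. -/
theorem eventually_resolventDefect_eq_zero (hρ : IsMomentDensity I ρ)
    (hμ : IsSecondaryDensity I ρ μ) (hρ1 : ∫ x in I, ρ x = 1) (p : ℝ[X]) :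
    ∀ᶠ y : ℝ in atTop, resolventDefect I ρ μ p (y * Complex.I) = 0 := by
  induction p using Polynomial.induction_on with
  | C a => exact Eventually.of_forall fun y => resolventDefect_C a _ hρ1
  | add p q hp hq =>
    filter_upwards [hp, hq, eventually_gt_atTop 0] with y hp hq hy
    rw [resolventDefect_add hρ hμ.isMomentDensity p q (by simpa using hy.ne'), hp, hq, add_zero]
  | monomial n a h =>
    filter_upwards [h, eventually_gt_atTop 0, eventually_stieltjes_ne_zero hρ hρ1] with y hy hy0 hS
    rw [show (C a * X ^ (n + 1) : ℝ[X]) = X * (C a * X ^ n) by ring,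
      resolventDefect_X_mul hρ hμ _ hy0.ne' hS, hy,
      momentDefect_eq_zero_of_resolventDefect hρ hμ hρ1 h]
    simp

theorem integral_secondaryFun_mul (hρ : IsMomentDensity I ρ) (hμ : IsSecondaryDensity I ρ μ)
    (hρ1 : ∫ x in I, ρ x = 1) (p : ℝ[X]) :
    ∫ x in I, secondaryFun I ρ p x * μ x =
      (∫ t in I, (X * p).eval t * ρ t) - moment I ρ 1 * ∫ t in I, p.eval t * ρ t := by
  have h := momentDefect_eq_zero_of_resolventDefect hρ hμ hρ1
    (eventually_resolventDefect_eq_zero hρ hμ hρ1 p)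
  unfold momentDefect at h
  linarith

theorem integral_secondaryFun_X_mul_mul (hρ : IsMomentDensity I ρ) (hμ : IsMomentDensity I μ)
    (p q : ℝ[X]) :
    ∫ x in I, secondaryFun I ρ (X * p) x * secondaryFun I ρ q x * μ x =
      (∫ x in I, x * (secondaryFun I ρ p x * secondaryFun I ρ q x * μ x)) +
        (∫ t in I, p.eval t * ρ t) * ∫ x in I, secondaryFun I ρ q x * μ x := by
  obtain ⟨r, hr⟩ := hρ.exists_secondaryFun_eq_eval p
  have h1 : IntegrableOn (fun x => x * (secondaryFun I ρ p x * secondaryFun I ρ q x * μ x)) I := by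
    have := integrableOn_secondaryFun_mul hρ hμ q (X * r)
    simpa only [hr, mul_assoc, eval_mul, eval_X] using this
  rw [← integral_const_mul, ← integral_add h1 ((integrableOn_secondaryFun hρ hμ q).const_mul _)]
  simp only [hρ.secondaryFun_X_mul]
  congr 1
  ext x
  ring

/-- The operator creating secondary polynomials preserves scalar products, up to the projection
onto the hyperplane orthogonal to the constants. -/
theorem integral_secondaryFun_mul_secondaryFun (hρ : IsMomentDensity I ρ)
    (hμ : IsSecondaryDensity I ρ μ) (hρ1 : ∫ x in I, ρ x = 1) (p q : ℝ[X]) :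
    ∫ x in I, secondaryFun I ρ p x * secondaryFun I ρ q x * μ x =
      (∫ t in I, (p * q).eval t * ρ t) -
        (∫ t in I, p.eval t * ρ t) * ∫ t in I, q.eval t * ρ t := by
  have hm := hμ.isMomentDensity
  induction p using Polynomial.induction_on generalizing q with
  | C a =>
    simp only [secondaryFun_C, eval_mul, eval_C, mul_assoc, integral_const_mul, hρ1]
    simp
  | add p₁ p₂ h₁ h₂ =>
    simp only [hρ.secondaryFun_add, add_mul, eval_add]
    rw [integral_add (integrableOn_secondaryFun_mul_secondaryFun hρ hm p₁ q)
      (integrableOn_secondaryFun_mul_secondaryFun hρ hm p₂ q), h₁, h₂,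
      integral_add (hρ.integrableOn_eval _) (hρ.integrableOn_eval _),
      integral_add (hρ.integrableOn_eval _) (hρ.integrableOn_eval _)]
    ring
  | monomial n a h =>
    rw [show (C a * X ^ (n + 1) : ℝ[X]) = X * (C a * X ^ n) by ring]
    generalize C a * X ^ n = p at h ⊢
    -- The factor `X` is moved from `p` to `q`: the hypothesis is applied to `p` and `X * q`, and
    -- both sides are expanded by the recursion for secondary polynomials.
    have h1 := h (X * q)
    have h2 : ∀ x, secondaryFun I ρ p x * secondaryFun I ρ (X * q) x * μ x =
        secondaryFun I ρ (X * q) x * secondaryFun I ρ p x * μ x := fun x => by ring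
    have h3 : ∀ x, x * (secondaryFun I ρ q x * secondaryFun I ρ p x * μ x) =
        x * (secondaryFun I ρ p x * secondaryFun I ρ q x * μ x) := fun x => by ring
    simp only [h2] at h1
    rw [integral_secondaryFun_X_mul_mul hρ hm, integral_secondaryFun_mul hρ hμ hρ1] at h1 ⊢
    simp only [h3] at h1
    rw [show X * p * q = p * (X * q) by ring]
    linear_combination h1

/-! ### Poisson integrals and the support of the secondary density -/

theorem integral_rpow_neg_half {b : ℝ} (hb : 0 < b) :
    IntegrableOn (fun s : ℝ => s ^ (-(1 / 2) : ℝ)) (Set.Ioc 0 b) ∧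
      ∫ s in Set.Ioc 0 b, s ^ (-(1 / 2) : ℝ) = 2 * √b := by
  constructor
  · rw [← intervalIntegrable_iff_integrableOn_Ioc_of_le hb.le]
    exact intervalIntegral.intervalIntegrable_rpow' (by norm_num)
  · rw [← intervalIntegral.integral_of_le hb.le, integral_rpow (Or.inl (by norm_num)),
      Real.zero_rpow (by norm_num), Real.sqrt_eq_rpow]
    norm_num
    ring

theorem continuous_poisson (x : ℝ) {ε : ℝ} (hε : 0 < ε) :
    Continuous fun t : ℝ => ε / ((x - t) ^ 2 + ε ^ 2) :=
  Continuous.div (by fun_prop) (by fun_prop) fun t => by positivity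

/-- Layer cake formula: the set where the kernel exceeds `s` lies in the ball of radius `√(ε / s)`
and is empty for `s > 1 / ε`. Integrating `c √(ε / s)` over `(0, 1 / ε]` gives `2 c`. -/
theorem lintegral_poisson_le {m : Measure ℝ} {x c : ℝ} (hc : 0 ≤ c)
    (h : ∀ r > 0, m (Metric.closedBall x r) ≤ ENNReal.ofReal (c * r)) {ε : ℝ} (hε : 0 < ε) :
    ∫⁻ t, ENNReal.ofReal (ε / ((x - t) ^ 2 + ε ^ 2)) ∂m ≤ ENNReal.ofReal (2 * c) := by
  rw [lintegral_eq_lintegral_meas_lt m (Eventually.of_forall fun t => by positivity)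
    (continuous_poisson x hε).aemeasurable]
  have hb : 0 < ε⁻¹ := inv_pos.mpr hε
  obtain ⟨hi, hv⟩ := integral_rpow_neg_half hb
  have key : ∀ s ∈ Set.Ioi (0 : ℝ), m {t | s < ε / ((x - t) ^ 2 + ε ^ 2)} ≤
      (Set.Ioc 0 ε⁻¹).indicator
        (fun s => ENNReal.ofReal (c * √ε * s ^ (-(1 / 2) : ℝ))) s := by
    intro s hs
    have hs0 : 0 < s := hs
    have hlt : ∀ t, s < ε / ((x - t) ^ 2 + ε ^ 2) → s * ((x - t) ^ 2 + ε ^ 2) < ε := fun t ht =>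
      (lt_div_iff₀ (by positivity)).mp ht
    by_cases hsb : s ≤ ε⁻¹
    · rw [Set.indicator_of_mem (show s ∈ Set.Ioc 0 ε⁻¹ from ⟨hs0, hsb⟩)]
      have hsub : {t | s < ε / ((x - t) ^ 2 + ε ^ 2)} ⊆
          Metric.closedBall x (√ε * s ^ (-(1 / 2) : ℝ)) := by
        intro t ht
        have h1 := hlt t ht
        have h2 : (x - t) ^ 2 ≤ ε / s := by
          rw [le_div_iff₀ hs0]
          nlinarith [mul_pos hs0 (pow_pos hε 2)]
        have h3 : √ε * s ^ (-(1 / 2) : ℝ) = √(ε / s) := by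
          rw [Real.rpow_neg hs0.le, ← Real.sqrt_eq_rpow, Real.sqrt_div hε.le, div_eq_mul_inv]
        rw [Metric.mem_closedBall, dist_comm, Real.dist_eq, h3]
        exact Real.abs_le_sqrt h2
      refine (measure_mono hsub).trans ((h _ (by positivity)).trans_eq ?_)
      rw [mul_assoc]
    · have hempty : {t | s < ε / ((x - t) ^ 2 + ε ^ 2)} = ∅ := by
        refine Set.eq_empty_of_forall_notMem fun t ht => hsb ?_
        have h1 := hlt t ht
        rw [← one_div, le_div_iff₀ hε]
        nlinarith [mul_nonneg hs0.le (sq_nonneg (x - t))]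
      simp [hempty]
  refine (setLIntegral_mono' measurableSet_Ioi key).trans ?_
  rw [lintegral_indicator measurableSet_Ioc, Measure.restrict_restrict measurableSet_Ioc,
    Set.inter_eq_left.mpr Set.Ioc_subset_Ioi_self,
    ← ofReal_integral_eq_lintegral_ofReal (hi.const_mul _)]
  · rw [integral_const_mul, hv]
    refine ENNReal.ofReal_le_ofReal (le_of_eq ?_)
    have : √ε * √ε⁻¹ = 1 := by
      rw [← Real.sqrt_mul hε.le, mul_inv_cancel₀ hε.ne', Real.sqrt_one]
    linear_combination (2 * c) * this
  · filter_upwards [ae_restrict_mem measurableSet_Ioc] with s hs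
    have := hs.1
    positivity

theorem integrable_poisson (m : Measure ℝ) [IsFiniteMeasure m] (x : ℝ) {ε : ℝ} (hε : 0 < ε) :
    Integrable (fun t => ε / ((x - t) ^ 2 + ε ^ 2)) m := by
  refine Integrable.of_bound (continuous_poisson x hε).aestronglyMeasurable (ε / ε ^ 2)
    (Eventually.of_forall fun t => ?_)
  rw [Real.norm_of_nonneg (by positivity)]
  gcongr
  nlinarith [sq_nonneg (x - t)]

/-- The part near `x` contributes at most `2 c` by the layer cake bound, applied to the restriction
of `m` to a small ball so that the hypothesis holds at all radii. The far part is `O(ε)`, eventually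
at most `c`. -/
theorem eventually_integral_poisson_le {m : Measure ℝ} [IsFiniteMeasure m] {x c : ℝ} (hc : 0 < c)
    (h : ∀ᶠ r in 𝓝[>] (0 : ℝ), m (Metric.closedBall x r) ≤ ENNReal.ofReal (c * r)) :
    ∀ᶠ ε in 𝓝[>] (0 : ℝ), ∫ t, ε / ((x - t) ^ 2 + ε ^ 2) ∂m ≤ 3 * c := by
  obtain ⟨r₀, hr₀, hr⟩ := (mem_nhdsGT_iff_exists_Ioc_subset).mp h
  replace hr₀ : 0 < r₀ := hr₀
  have hlim : Tendsto (fun ε : ℝ => ε / r₀ ^ 2 * m.real (Metric.closedBall x r₀)ᶜ) (𝓝[>] 0)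
      (𝓝 0) := by
    have : Tendsto (fun ε : ℝ => ε / r₀ ^ 2 * m.real (Metric.closedBall x r₀)ᶜ) (𝓝 0)
        (𝓝 (0 / r₀ ^ 2 * m.real (Metric.closedBall x r₀)ᶜ)) :=
      Continuous.tendsto (by fun_prop) 0
    rw [zero_div, zero_mul] at this
    exact this.mono_left nhdsWithin_le_nhds
  filter_upwards [hlim.eventually_le_const hc, self_mem_nhdsWithin] with ε hfar hε
  replace hε : 0 < ε := hε
  have hint := integrable_poisson m x hε
  rw [← integral_add_compl (Metric.isClosed_closedBall (x := x) (ε := r₀)).measurableSet hint]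
  have hnear : ∫ t in Metric.closedBall x r₀, ε / ((x - t) ^ 2 + ε ^ 2) ∂m ≤ 2 * c := by
    rw [integral_eq_lintegral_of_nonneg_ae (Eventually.of_forall fun t => by positivity)
      (continuous_poisson x hε).aestronglyMeasurable]
    refine ENNReal.toReal_le_of_le_ofReal (by positivity) (lintegral_poisson_le hc.le ?_ hε)
    intro r hr'
    rcases le_total r r₀ with hle | hle
    · exact (Measure.restrict_apply_le _ _).trans (hr ⟨hr', hle⟩)
    · rw [Measure.restrict_apply Metric.isClosed_closedBall.measurableSet]
      refine (measure_mono Set.inter_subset_right).trans ((hr ⟨hr₀, le_rfl⟩).trans ?_)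
      gcongr
  have hfar' : ∫ t in (Metric.closedBall x r₀)ᶜ, ε / ((x - t) ^ 2 + ε ^ 2) ∂m ≤
      ε / r₀ ^ 2 * m.real (Metric.closedBall x r₀)ᶜ := by
    have h1 : ∫ t in (Metric.closedBall x r₀)ᶜ, ε / ((x - t) ^ 2 + ε ^ 2) ∂m ≤
        ∫ t in (Metric.closedBall x r₀)ᶜ, ε / r₀ ^ 2 ∂m := by
      refine setIntegral_mono_on hint.integrableOn (integrable_const _).integrableOn
        Metric.isClosed_closedBall.measurableSet.compl fun t ht => ?_
      have h2 : r₀ < |x - t| := by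
        rw [Set.mem_compl_iff, Metric.mem_closedBall, dist_comm, Real.dist_eq, not_le] at ht
        exact ht
      have h3 : r₀ ^ 2 ≤ (x - t) ^ 2 := by
        rw [← sq_abs (x - t)]
        gcongr
      gcongr
      nlinarith [sq_nonneg ε]
    rwa [setIntegral_const, smul_eq_mul, mul_comm] at h1
  linarith

/-- On the ball of radius `ε` around `x` the kernel is at least `1 / (2 ε)`. -/
theorem eventually_le_integral_poisson {m : Measure ℝ} [IsFiniteMeasure m] {x c : ℝ}
    (h : ∀ᶠ r in 𝓝[>] (0 : ℝ), ENNReal.ofReal (c * r) ≤ m (Metric.closedBall x r)) :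
    ∀ᶠ ε in 𝓝[>] (0 : ℝ), c / 2 ≤ ∫ t, ε / ((x - t) ^ 2 + ε ^ 2) ∂m := by
  filter_upwards [h, self_mem_nhdsWithin] with ε hm hε
  replace hε : 0 < ε := hε
  have hint := integrable_poisson m x hε
  have h0 : c * ε ≤ m.real (Metric.closedBall x ε) :=
    (ENNReal.ofReal_le_iff_le_toReal (measure_ne_top _ _)).mp hm
  calc c / 2 = 1 / (2 * ε) * (c * ε) := by field_simp
    _ ≤ 1 / (2 * ε) * m.real (Metric.closedBall x ε) := by gcongr
    _ = ∫ t in Metric.closedBall x ε, 1 / (2 * ε) ∂m := by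
      rw [setIntegral_const, smul_eq_mul, mul_comm]
    _ ≤ ∫ t in Metric.closedBall x ε, ε / ((x - t) ^ 2 + ε ^ 2) ∂m := by
      refine setIntegral_mono_on (integrable_const _).integrableOn hint.integrableOn
        Metric.isClosed_closedBall.measurableSet fun t ht => ?_
      rw [Metric.mem_closedBall, dist_comm, Real.dist_eq] at ht
      have h3 : (x - t) ^ 2 ≤ ε ^ 2 := by
        rw [← sq_abs (x - t)]
        gcongr
      rw [div_le_div_iff₀ (by positivity) (by positivity)]
      nlinarith
    _ ≤ ∫ t, ε / ((x - t) ^ 2 + ε ^ 2) ∂m :=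
      setIntegral_le_integral hint (Eventually.of_forall fun t => by positivity)

/-! ### Differentiation of measures and boundary behaviour of Stieltjes transforms -/

theorem IsMomentDensity.isFiniteMeasure (h : IsMomentDensity I w) :
    IsFiniteMeasure (densityMeasure I w) := by
  refine isFiniteMeasure_withDensity ?_
  exact h.integrableOn_self.lintegral_lt_top.ne

theorem IsMomentDensity.integral_densityMeasure {E : Type*} [NormedAddCommGroup E]
    [NormedSpace ℝ E] (h : IsMomentDensity I w) (g : ℝ → E) :
    ∫ x, g x ∂densityMeasure I w = ∫ x in I, w x • g x := by
  rw [densityMeasure, integral_withDensity_eq_integral_toReal_smul₀ h.aemeasurable.ennreal_ofReal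
    (by simp)]
  refine integral_congr_ae ?_
  filter_upwards [h.nonneg] with x hx
  rw [ENNReal.toReal_ofReal hx]

theorem IsMomentDensity.ae_tendsto_measure_closedBall_div (h : IsMomentDensity I w)
    (hI : MeasurableSet I) : ∀ᵐ x ∂(volume.restrict I),
      Tendsto (fun r => densityMeasure I w (Metric.closedBall x r) / ENNReal.ofReal (2 * r))
        (𝓝[>] 0) (𝓝 (ENNReal.ofReal (w x))) := by
  have := h.isFiniteMeasure
  have hm : AEMeasurable (I.indicator fun x => ENNReal.ofReal (w x)) volume :=
    (aemeasurable_indicator_iff hI).mpr h.aemeasurable.ennreal_ofReal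
  rw [ae_restrict_iff' hI]
  have h1 := Measure.rnDeriv_withDensity₀ volume hm
  rw [withDensity_indicator hI] at h1
  filter_upwards [Besicovitch.ae_tendsto_rnDeriv (densityMeasure I w) volume, h1] with x hx h1 hxI
  rw [densityMeasure] at hx
  rw [h1, Set.indicator_of_mem hxI] at hx
  simp only [Real.volume_closedBall] at hx
  exact hx

theorem eventually_measure_closedBall_le {m : Measure ℝ} {x a c : ℝ} (hc : 0 < c) (hac : a < c)
    (h : Tendsto (fun r => m (Metric.closedBall x r) / ENNReal.ofReal (2 * r)) (𝓝[>] 0)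
      (𝓝 (ENNReal.ofReal a))) :
    ∀ᶠ r in 𝓝[>] (0 : ℝ), m (Metric.closedBall x r) ≤ ENNReal.ofReal (2 * c * r) := by
  have h1 : ENNReal.ofReal a < ENNReal.ofReal c := (ENNReal.ofReal_lt_ofReal_iff hc).mpr hac
  filter_upwards [h.eventually_le_const h1, self_mem_nhdsWithin] with r hr hr0
  replace hr0 : 0 < r := hr0
  rw [ENNReal.div_le_iff (by simpa using hr0) ENNReal.ofReal_ne_top, ← ENNReal.ofReal_mul hc.le] at hr
  rwa [show 2 * c * r = c * (2 * r) by ring]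

theorem eventually_le_measure_closedBall {m : Measure ℝ} {x a c : ℝ} (hc : 0 < c) (hca : c < a)
    (h : Tendsto (fun r => m (Metric.closedBall x r) / ENNReal.ofReal (2 * r)) (𝓝[>] 0)
      (𝓝 (ENNReal.ofReal a))) :
    ∀ᶠ r in 𝓝[>] (0 : ℝ), ENNReal.ofReal (2 * c * r) ≤ m (Metric.closedBall x r) := by
  have h1 : ENNReal.ofReal c < ENNReal.ofReal a :=
    (ENNReal.ofReal_lt_ofReal_iff (hc.trans hca)).mpr hca
  filter_upwards [h.eventually_const_le h1, self_mem_nhdsWithin] with r hr hr0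
  replace hr0 : 0 < r := hr0
  rw [ENNReal.le_div_iff_mul_le (Or.inl (by simpa using hr0))
    (Or.inl ENNReal.ofReal_ne_top),
    ← ENNReal.ofReal_mul hc.le] at hr
  rwa [show 2 * c * r = c * (2 * r) by ring]

theorem ofReal_div_sub_eq (a x t : ℝ) {ε : ℝ} (hε : 0 < ε) :
    (a : ℂ) / ((x + ε * Complex.I) - t) =
      (((x - t) * a / ((x - t) ^ 2 + ε ^ 2) : ℝ) : ℂ) -
        ((a * (ε / ((x - t) ^ 2 + ε ^ 2)) : ℝ) : ℂ) * Complex.I := by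
  have h1 : ((x : ℂ) + ε * Complex.I) - t ≠ 0 := sub_ofReal_ne_zero (by simpa using hε.ne') t
  have h2 : (((x - t) ^ 2 + ε ^ 2 : ℝ) : ℂ) ≠ 0 := by
    exact_mod_cast (by positivity : (x - t) ^ 2 + ε ^ 2 ≠ 0)
  push_cast at h2 ⊢
  field_simp
  linear_combination (a : ℂ) * ε ^ 2 * Complex.I_sq

theorem IsMomentDensity.im_stieltjes (h : IsMomentDensity I w) (x : ℝ) {ε : ℝ} (hε : 0 < ε) :
    (stieltjes I w (x + ε * Complex.I)).im =
      -∫ t, ε / ((x - t) ^ 2 + ε ^ 2) ∂densityMeasure I w := by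
  have h1 := integrableOn_stieltjes h.integrableOn_self (z := x + ε * Complex.I)
    (by simpa using hε.ne')
  rw [h.integral_densityMeasure, ← integral_neg, stieltjes, ← Complex.imCLM_apply,
    ← Complex.imCLM.integral_comp_comm h1]
  congr 1
  ext t
  rw [ofReal_div_sub_eq _ _ _ hε]
  simp [-Complex.ofReal_mul, -Complex.ofReal_div]

theorem IsMomentDensity.re_stieltjes (h : IsMomentDensity I w) (x : ℝ) {ε : ℝ} (hε : 0 < ε) :
    (stieltjes I w (x + ε * Complex.I)).re = approxReducer I w ε x / 2 := by
  have h1 := integrableOn_stieltjes h.integrableOn_self (z := x + ε * Complex.I)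
    (by simpa using hε.ne')
  rw [approxReducer, mul_div_cancel_left₀ _ two_ne_zero, stieltjes, ← Complex.reCLM_apply,
    ← Complex.reCLM.integral_comp_comm h1]
  congr 1
  ext t
  rw [ofReal_div_sub_eq _ _ _ hε]
  simp [-Complex.ofReal_mul, -Complex.ofReal_div]

/-- The density `ρ` vanishes almost everywhere on the zero set of a secondary density, as soon as
its reducer is almost everywhere defined. -/
theorem IsSecondaryDensity.ae_nonpos_of_nonpos (hμ : IsSecondaryDensity I ρ μ)
    (hρ : IsMomentDensity I ρ) (hI : MeasurableSet I)
    (hφ : ∀ᵐ x ∂(volume.restrict I), ∃ l : ℝ,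
      Tendsto (fun ε => approxReducer I ρ ε x) (𝓝[>] (0 : ℝ)) (𝓝 l)) :
    ∀ᵐ x ∂(volume.restrict I), μ x ≤ 0 → ρ x ≤ 0 := by
  have := hρ.isFiniteMeasure
  have := hμ.isMomentDensity.isFiniteMeasure
  filter_upwards [hρ.ae_tendsto_measure_closedBall_div hI,
    hμ.isMomentDensity.ae_tendsto_measure_closedBall_div hI, hφ] with x h1 h2 ⟨l, hl⟩ h3
  by_contra! h4
  have hlow := eventually_le_integral_poisson
    (eventually_le_measure_closedBall (half_pos h4) (half_lt_self h4) h1)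
  have hup := eventually_integral_poisson_le (by positivity)
    (eventually_measure_closedBall_le (c := 2 * ρ x) (by positivity) (by linarith) h1)
  set c := 2 * (ρ x / 2) / 2 with hc
  have hc0 : 0 < c := by positivity
  -- `S_ρ (x + iε)` stays bounded: its real part is half the approximate reducer, which converges at
  -- `x`, and its imaginary part is minus a Poisson integral, bounded by `hup`.
  obtain ⟨M, hM0, hM⟩ : ∃ M > (0 : ℝ), ∀ᶠ ε : ℝ in 𝓝[>] (0 : ℝ),
      Complex.normSq (stieltjes I ρ ((x : ℂ) + (ε : ℂ) * Complex.I)) ≤ M := by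
    refine ⟨(|l| + 1) ^ 2 + (3 * (2 * (2 * ρ x))) ^ 2, by positivity, ?_⟩
    filter_upwards [hlow, hup, hl.abs.eventually_le_const (lt_add_one |l|),
      self_mem_nhdsWithin] with ε h5 h6 h7 hε
    rw [Complex.normSq_apply, hρ.im_stieltjes x hε, hρ.re_stieltjes x hε, ← sq, ← sq, neg_sq]
    have h8 : (approxReducer I ρ ε x / 2) ^ 2 ≤ (|l| + 1) ^ 2 := by
      rw [div_pow, ← sq_abs]
      have : |approxReducer I ρ ε x| ^ 2 ≤ (|l| + 1) ^ 2 := by gcongr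
      nlinarith [sq_nonneg |approxReducer I ρ ε x|]
    have h9 : 0 ≤ ∫ t, ε / ((x - t) ^ 2 + ε ^ 2) ∂densityMeasure I ρ := hc0.le.trans h5
    gcongr
  have hη : 0 < c / M := by positivity
  -- With `P` the Poisson integral, the imaginary part of the secondary relation reads `P μ + ε = P
  -- ρ / |S_ρ|²`, which is at least `c / M`. The constant 18 makes `P μ ≤ c / M / 3`; with `ε < c /
  -- M / 3` this is a contradiction.
  have hμ' := eventually_integral_poisson_le (by positivity)
    (eventually_measure_closedBall_le (c := c / M / 18) (by positivity) (by linarith) h2)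
  have hsmall : ∀ᶠ ε in 𝓝[>] (0 : ℝ), ε < c / M / 3 :=
    eventually_nhdsWithin_of_eventually_nhds (eventually_lt_nhds (by positivity))
  obtain ⟨ε, h5, h6, h7, h8, hε⟩ :=
    (hlow.and (hM.and (hμ'.and (hsmall.and self_mem_nhdsWithin)))).exists
  replace hε : 0 < ε := hε
  have hz : (x : ℂ) + ε * Complex.I ∉ (fun x : ℝ => (x : ℂ)) '' closure I := by
    rintro ⟨u, -, hu⟩
    exact hε.ne' (by simpa using (congrArg Complex.im hu).symm)
  have h9 := congrArg Complex.im (hμ.stieltjes_eq _ hz)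
  rw [hμ.isMomentDensity.im_stieltjes x hε, one_div, Complex.sub_im, Complex.sub_im,
    Complex.inv_im, hρ.im_stieltjes x hε] at h9
  simp only [Complex.add_im, Complex.ofReal_im, Complex.mul_im, Complex.ofReal_re, Complex.I_im,
    Complex.I_re, neg_neg] at h9
  have h10 : 0 < Complex.normSq (stieltjes I ρ (x + ε * Complex.I)) := by
    rw [Complex.normSq_pos]
    intro h
    have := hρ.im_stieltjes x hε
    rw [h, Complex.zero_im] at this
    linarith
  have h11 : c / M ≤ (∫ t, ε / ((x - t) ^ 2 + ε ^ 2) ∂densityMeasure I ρ) /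
      Complex.normSq (stieltjes I ρ (x + ε * Complex.I)) :=
    div_le_div₀ (hc0.le.trans h5) h5 h10 h6
  linarith

/-! ### Scalar products with the reducer -/

theorem IsMomentDensity.integrable_eval (h : IsMomentDensity I w) (p : ℝ[X]) :
    Integrable (fun x => p.eval x) (densityMeasure I w) :=
  have := h.isFiniteMeasure
  (h.memLp_eval p).integrable one_le_two

theorem approxReducer_eq (h : IsMomentDensity I w) (ε x : ℝ) :
    approxReducer I w ε x =
      2 * ∫ t, (x - t) / ((x - t) ^ 2 + ε ^ 2) ∂densityMeasure I w := by
  rw [h.integral_densityMeasure, approxReducer]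
  congr 2
  ext t
  rw [smul_eq_mul]
  ring

theorem secondaryFun_eq (h : IsMomentDensity I w) (p : ℝ[X]) (x : ℝ) :
    secondaryFun I w p x = ∫ t, (p.eval t - p.eval x) / (t - x) ∂densityMeasure I w := by
  rw [h.integral_densityMeasure, secondaryFun]
  congr 1
  ext t
  rw [smul_eq_mul, mul_comm]

theorem continuous_conjPoisson {ε : ℝ} (hε : 0 < ε) :
    Continuous fun z : ℝ × ℝ => (z.1 - z.2) / ((z.1 - z.2) ^ 2 + ε ^ 2) :=
  Continuous.div (by fun_prop) (by fun_prop) fun t => by positivity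

theorem abs_conjPoisson_le {ε : ℝ} (hε : 0 < ε) (a : ℝ) : |a / (a ^ 2 + ε ^ 2)| ≤ ε⁻¹ := by
  have h : 0 < a ^ 2 + ε ^ 2 := by positivity
  rw [abs_div, abs_of_pos h, div_le_iff₀ h, ← sq_abs a, inv_mul_eq_div, le_div_iff₀ hε]
  nlinarith [sq_nonneg (|a| - ε), abs_nonneg a]

/-- The bound does not depend on `ε`: it supplies the dominating function, a divided difference, for
the limit `ε → 0`. -/
theorem abs_conjPoisson_mul_le (ε a d : ℝ) : |a / (a ^ 2 + ε ^ 2) * d| ≤ |d / a| := by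
  by_cases ha : a = 0
  · simp [ha]
  have h : 0 < a ^ 2 + ε ^ 2 := by positivity
  have ha' : 0 < |a| := abs_pos.mpr ha
  rw [abs_mul, abs_div, abs_div, abs_of_pos h, div_mul_eq_mul_div, div_le_div_iff₀ h ha',
    ← sq_abs a]
  nlinarith [mul_nonneg (abs_nonneg d) (sq_nonneg ε)]

theorem IsMomentDensity.integrable_dividedDifference (h : IsMomentDensity I w) (p : ℝ[X]) :
    Integrable (fun z : ℝ × ℝ => (p.eval z.2 - p.eval z.1) / (z.2 - z.1))
      ((densityMeasure I w).prod (densityMeasure I w)) := by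
  have := h.isFiniteMeasure
  induction p using Polynomial.induction_on' with
  | add p q hp hq =>
    refine (hp.add hq).congr (Eventually.of_forall fun z => ?_)
    simp only [Pi.add_apply, eval_add]
    ring
  | monomial n a =>
    have h1 : Integrable (fun z : ℝ × ℝ =>
        ∑ k ∈ Finset.range n, |a| * ‖z.1 ^ (n - 1 - k) * z.2 ^ k‖)
        ((densityMeasure I w).prod (densityMeasure I w)) := by
      refine integrable_finsetSum _ fun k _ => Integrable.const_mul (Integrable.norm ?_) _
      refine Integrable.mul_prod (f := fun x : ℝ => x ^ (n - 1 - k)) (g := fun x : ℝ => x ^ k) ?_ ?_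
      · simpa using h.integrable_eval (X ^ (n - 1 - k))
      · simpa using h.integrable_eval (X ^ k)
    refine h1.mono' (Measurable.aestronglyMeasurable (by fun_prop))
      (Eventually.of_forall fun z => ?_)
    by_cases hz : z.2 - z.1 = 0
    · rw [hz, div_zero, norm_zero]
      positivity
    · simp only [eval_monomial]
      rw [← mul_sub, ← geom_sum₂_mul z.2 z.1 n, ← mul_assoc, mul_div_cancel_right₀ _ hz, norm_mul,
        ← Finset.mul_sum, Real.norm_eq_abs a]
      gcongr
      refine (norm_sum_le _ _).trans_eq (Finset.sum_congr rfl fun k _ => ?_)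
      rw [mul_comm]

/-- The kernel is odd under exchange of the two variables, so twice the integral against `p(x)` is
the integral against `p(x) - p(t)`, which cancels the singularity on the diagonal. -/
theorem IsMomentDensity.integral_approxReducer_mul_eval (h : IsMomentDensity I w) (p : ℝ[X])
    {ε : ℝ} (hε : 0 < ε) :
    ∫ x, approxReducer I w ε x * p.eval x ∂densityMeasure I w =
      ∫ z : ℝ × ℝ, (z.1 - z.2) / ((z.1 - z.2) ^ 2 + ε ^ 2) * (p.eval z.1 - p.eval z.2)
        ∂((densityMeasure I w).prod (densityMeasure I w)) := by
  have := h.isFiniteMeasure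
  have hG : Integrable
      (fun z : ℝ × ℝ => (z.1 - z.2) / ((z.1 - z.2) ^ 2 + ε ^ 2) * p.eval z.1)
      ((densityMeasure I w).prod (densityMeasure I w)) := by
    refine ((h.integrable_eval p).comp_fst _).bdd_mul (c := ε⁻¹)
      (continuous_conjPoisson hε).aestronglyMeasurable (Eventually.of_forall fun z => ?_)
    exact abs_conjPoisson_le hε _
  have h1 : ∫ x, approxReducer I w ε x * p.eval x ∂densityMeasure I w =
      2 * ∫ z : ℝ × ℝ, (z.1 - z.2) / ((z.1 - z.2) ^ 2 + ε ^ 2) * p.eval z.1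
        ∂((densityMeasure I w).prod (densityMeasure I w)) := by
    rw [integral_prod _ hG, ← integral_const_mul]
    congr 1
    ext x
    simp only
    rw [integral_mul_const, approxReducer_eq h, mul_assoc]
  have h2 : ∀ z : ℝ × ℝ, (z.1 - z.2) / ((z.1 - z.2) ^ 2 + ε ^ 2) * (p.eval z.1 - p.eval z.2) =
      (z.1 - z.2) / ((z.1 - z.2) ^ 2 + ε ^ 2) * p.eval z.1 +
        (z.swap.1 - z.swap.2) / ((z.swap.1 - z.swap.2) ^ 2 + ε ^ 2) * p.eval z.swap.1 := by
    intro z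
    rw [Prod.fst_swap, Prod.snd_swap, ← neg_sub z.1 z.2, neg_sq]
    ring
  simp only [h2]
  rw [h1, two_mul]
  exact ((integral_add hG hG.swap).trans (congrArg _ (integral_prod_swap
    fun z : ℝ × ℝ => (z.1 - z.2) / ((z.1 - z.2) ^ 2 + ε ^ 2) * p.eval z.1))).symm

theorem IsMomentDensity.tendsto_integral_approxReducer_mul_eval (h : IsMomentDensity I w)
    (p : ℝ[X]) :
    Tendsto (fun ε => ∫ x, approxReducer I w ε x * p.eval x ∂densityMeasure I w) (𝓝[>] (0 : ℝ))
      (𝓝 (∫ x, secondaryFun I w p x ∂densityMeasure I w)) := by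
  have := h.isFiniteMeasure
  have hD := h.integrable_dividedDifference p
  simp only [secondaryFun_eq h]
  rw [← integral_prod _ hD]
  have hT : Tendsto (fun ε : ℝ => ∫ z : ℝ × ℝ,
      (z.1 - z.2) / ((z.1 - z.2) ^ 2 + ε ^ 2) * (p.eval z.1 - p.eval z.2)
        ∂((densityMeasure I w).prod (densityMeasure I w))) (𝓝[>] (0 : ℝ))
      (𝓝 (∫ z : ℝ × ℝ, (p.eval z.2 - p.eval z.1) / (z.2 - z.1)
        ∂((densityMeasure I w).prod (densityMeasure I w)))) := by
    refine tendsto_integral_filter_of_dominated_convergence _ ?_ ?_ hD.norm ?_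
    · exact Eventually.of_forall fun ε => Measurable.aestronglyMeasurable (by fun_prop)
    · refine Eventually.of_forall fun ε => Eventually.of_forall fun z => ?_
      refine (abs_conjPoisson_mul_le ε _ _).trans_eq ?_
      rw [← neg_sub z.2 z.1, ← neg_sub (p.eval z.2), neg_div_neg_eq, Real.norm_eq_abs]
    · refine Eventually.of_forall fun z => ?_
      -- On the diagonal both the integrand and its limit are 0, by the convention `0 / 0 = 0`.
      by_cases hz : z.1 = z.2
      · simp [hz]
      have hz' := sub_ne_zero.mpr hz
      have hc : ContinuousAt (fun ε : ℝ =>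
          (z.1 - z.2) / ((z.1 - z.2) ^ 2 + ε ^ 2) * (p.eval z.1 - p.eval z.2)) 0 := by
        refine ContinuousAt.mul (ContinuousAt.div continuousAt_const (by fun_prop) ?_)
          continuousAt_const
        simpa using hz'
      have he : (z.1 - z.2) / ((z.1 - z.2) ^ 2 + 0 ^ 2) * (p.eval z.1 - p.eval z.2) =
          (p.eval z.2 - p.eval z.1) / (z.2 - z.1) := by
        rw [← neg_sub z.1 z.2, ← neg_sub (p.eval z.1), neg_div_neg_eq]
        field_simp
        simp
      have := hc.tendsto
      rw [he] at this
      exact this.mono_left nhdsWithin_le_nhds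
  refine hT.congr' ?_
  filter_upwards [self_mem_nhdsWithin] with ε hε
  exact (h.integral_approxReducer_mul_eval p hε).symm

theorem IsMomentDensity.memLp_approxReducer (h : IsMomentDensity I w) {ε : ℝ} (hε : 0 < ε) :
    MemLp (approxReducer I w ε) 2 (densityMeasure I w) := by
  have := h.isFiniteMeasure
  have h1 : approxReducer I w ε = fun x =>
      2 * ∫ t, (x - t) / ((x - t) ^ 2 + ε ^ 2) ∂densityMeasure I w := funext (approxReducer_eq h ε)
  have h2 : StronglyMeasurable fun x : ℝ =>
      ∫ t, (x - t) / ((x - t) ^ 2 + ε ^ 2) ∂densityMeasure I w :=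
    (continuous_conjPoisson hε).stronglyMeasurable.integral_prod_right
  rw [h1]
  refine MemLp.of_bound (h2.const_mul 2).aestronglyMeasurable
    (2 * (ε⁻¹ * (densityMeasure I w).real Set.univ)) (Eventually.of_forall fun x => ?_)
  rw [norm_mul, Real.norm_two]
  gcongr
  exact norm_integral_le_of_norm_le_const (Eventually.of_forall fun t => abs_conjPoisson_le hε _)

/-! ### The operator -/

theorem inner_polyToL2 (h : IsMomentDensity I w) {f : ℝ → ℝ}
    (hf : MemLp f 2 (densityMeasure I w)) (p : ℝ[X]) :
    inner ℝ (hf.toLp f) (polyToL2 h p) = ∫ x, f x * p.eval x ∂densityMeasure I w := by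
  rw [L2.inner_def]
  refine integral_congr_ae ?_
  filter_upwards [hf.coeFn_toLp, (h.memLp_eval p).coeFn_toLp] with x h1 h2
  have h2' : polyToL2 h p x = p.eval x := h2
  rw [h1, h2']
  exact mul_comm _ _

theorem inner_polyToL2_polyToL2 (h : IsMomentDensity I w) (p q : ℝ[X]) :
    inner ℝ (polyToL2 h p) (polyToL2 h q) = ∫ t in I, (p * q).eval t * w t := by
  refine (inner_polyToL2 h (h.memLp_eval p) q).trans ?_
  rw [h.integral_densityMeasure]
  congr 1
  ext t
  rw [smul_eq_mul, eval_mul, mul_comm]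

theorem inner_secondaryToL2 (hρ : IsMomentDensity I ρ) (hμ : IsSecondaryDensity I ρ μ)
    (hρ1 : ∫ x in I, ρ x = 1) (p q : ℝ[X]) :
    inner ℝ (secondaryToL2 hρ hμ.isMomentDensity p) (secondaryToL2 hρ hμ.isMomentDensity q) =
      inner ℝ (polyToL2 hρ p) (polyToL2 hρ q) -
        inner ℝ (polyToL2 hρ 1) (polyToL2 hρ p) * inner ℝ (polyToL2 hρ 1) (polyToL2 hρ q) := by
  have hm := hμ.isMomentDensity
  simp only [inner_polyToL2_polyToL2, one_mul]
  rw [← integral_secondaryFun_mul_secondaryFun hρ hμ hρ1, L2.inner_def]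
  have h1 : ∀ᵐ x ∂densityMeasure I μ,
      inner ℝ (secondaryToL2 hρ hm p x) (secondaryToL2 hρ hm q x) =
        secondaryFun I ρ p x * secondaryFun I ρ q x := by
    filter_upwards [(memLp_secondaryFun hρ hm p).coeFn_toLp,
      (memLp_secondaryFun hρ hm q).coeFn_toLp] with x h1 h2
    have h1' : secondaryToL2 hρ hm p x = secondaryFun I ρ p x := h1
    have h2' : secondaryToL2 hρ hm q x = secondaryFun I ρ q x := h2
    rw [h1', h2']
    exact mul_comm _ _
  rw [integral_congr_ae h1, hm.integral_densityMeasure]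
  congr 1
  ext x
  rw [smul_eq_mul, mul_comm]

theorem norm_secondaryToL2_le (hρ : IsMomentDensity I ρ) (hμ : IsSecondaryDensity I ρ μ)
    (hρ1 : ∫ x in I, ρ x = 1) (p : ℝ[X]) :
    ‖secondaryToL2 hρ hμ.isMomentDensity p‖ ≤ 1 * ‖polyToL2 hρ p‖ := by
  have h := inner_secondaryToL2 hρ hμ hρ1 p p
  rw [real_inner_self_eq_norm_sq, real_inner_self_eq_norm_sq] at h
  rw [one_mul]
  refine le_of_sq_le_sq ?_ (norm_nonneg _)
  nlinarith [mul_self_nonneg (inner ℝ (polyToL2 hρ 1) (polyToL2 hρ p))]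

theorem secondaryOperator_polyToL2 (hρ : IsMomentDensity I ρ) (hμ : IsSecondaryDensity I ρ μ)
    (hρ1 : ∫ x in I, ρ x = 1) (hdense : DenseRange (polyToL2 hρ)) (p : ℝ[X]) :
    secondaryOperator hρ hμ.isMomentDensity (polyToL2 hρ p) =
      secondaryToL2 hρ hμ.isMomentDensity p :=
  LinearMap.extendOfNorm_eq hdense ⟨1, norm_secondaryToL2_le hρ hμ hρ1⟩ p

theorem inner_secondaryOperator (hρ : IsMomentDensity I ρ) (hμ : IsSecondaryDensity I ρ μ)
    (hρ1 : ∫ x in I, ρ x = 1) (hdense : DenseRange (polyToL2 hρ))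
    (f g : Lp ℝ 2 (densityMeasure I ρ)) :
    inner ℝ (secondaryOperator hρ hμ.isMomentDensity f)
        (secondaryOperator hρ hμ.isMomentDensity g) =
      inner ℝ f g - inner ℝ (polyToL2 hρ 1) f * inner ℝ (polyToL2 hρ 1) g := by
  refine hdense.induction_on f (isClosed_eq (by fun_prop) (by fun_prop)) fun p => ?_
  refine hdense.induction_on g (isClosed_eq (by fun_prop) (by fun_prop)) fun q => ?_
  rw [secondaryOperator_polyToL2 hρ hμ hρ1 hdense, secondaryOperator_polyToL2 hρ hμ hρ1 hdense,
    inner_secondaryToL2 hρ hμ hρ1]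

theorem mem_hyperplane_iff (hρ : IsMomentDensity I ρ) (f : Lp ℝ 2 (densityMeasure I ρ)) :
    f ∈ hyperplane hρ ↔ inner ℝ (polyToL2 hρ 1) f = 0 :=
  Submodule.mem_orthogonal_singleton_iff_inner_right

/-- The operator `T_ρ` is isometric, hence injective, on the hyperplane. -/
theorem eq_of_secondaryOperator_eq (hρ : IsMomentDensity I ρ) (hμ : IsSecondaryDensity I ρ μ)
    (hρ1 : ∫ x in I, ρ x = 1) (hdense : DenseRange (polyToL2 hρ))
    {f g : Lp ℝ 2 (densityMeasure I ρ)} (hf : f ∈ hyperplane hρ) (hg : g ∈ hyperplane hρ)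
    (h : secondaryOperator hρ hμ.isMomentDensity f =
      secondaryOperator hρ hμ.isMomentDensity g) : f = g := by
  have h1 := inner_secondaryOperator hρ hμ hρ1 hdense (f - g) (f - g)
  rw [(mem_hyperplane_iff hρ _).mp (sub_mem hf hg), map_sub, h, sub_self, inner_zero_left, mul_zero,
    sub_zero] at h1
  exact sub_eq_zero.mp (inner_self_eq_zero.mp h1.symm)

theorem IsReducible.inner_reducerL2 {hρ : IsMomentDensity I ρ} {hμ : IsMomentDensity I μ}
    (h : IsReducible hρ hμ) (p : ℝ[X]) :
    inner ℝ h.reducerL2 (polyToL2 hρ p) =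
      ∫ x, secondaryFun I ρ p x ∂densityMeasure I ρ := by
  -- The parameter ranges over the subtype of positive reals, since membership of the approximations
  -- in `L²` is established only for `ε > 0`.
  have h1 : Tendsto
      (fun ε : Set.Ioi (0 : ℝ) => (hρ.memLp_approxReducer ε.2).toLp (approxReducer I ρ ε))
      (comap (Subtype.val : Set.Ioi (0 : ℝ) → ℝ) (𝓝[>] 0)) (𝓝 h.reducerL2) :=
    (Lp.tendsto_Lp_iff_tendsto_eLpNorm'' (fun ε : Set.Ioi (0 : ℝ) => approxReducer I ρ ε)
      (fun ε => hρ.memLp_approxReducer ε.2) _ h.memLp_reducer).mpr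
      (h.tendsto_reducer.comp tendsto_comap)
  have h2 := h1.inner (tendsto_const_nhds (x := polyToL2 hρ p)) (𝕜 := ℝ)
  simp only [inner_polyToL2] at h2
  have : (comap (Subtype.val : Set.Ioi (0 : ℝ) → ℝ) (𝓝[>] 0)).NeBot :=
    NeBot.comap_of_range_mem inferInstance (by rw [Subtype.range_coe]; exact self_mem_nhdsWithin)
  exact tendsto_nhds_unique h2
    ((hρ.tendsto_integral_approxReducer_mul_eval p).comp tendsto_comap)

/-- The secondary polynomial of the constant 1 is zero. -/
theorem IsReducible.reducerL2_mem_hyperplane {hρ : IsMomentDensity I ρ}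
    {hμ : IsMomentDensity I μ} (h : IsReducible hρ hμ) : h.reducerL2 ∈ hyperplane hρ := by
  rw [mem_hyperplane_iff, real_inner_comm, h.inner_reducerL2]
  simp [← C_1, secondaryFun_C, -map_one]

/-- An antecedent of `ρ / μ` has the same scalar products as the reducer with the polynomials. -/
theorem IsAntecedent.inner_secondaryToL2 {hρ : IsMomentDensity I ρ} {hμ : IsMomentDensity I μ}
    {f : Lp ℝ 2 (densityMeasure I ρ)} (hf : IsAntecedent hρ hμ f)
    (h0 : ∀ᵐ x ∂(volume.restrict I), μ x ≤ 0 → ρ x ≤ 0) (p : ℝ[X]) :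
    inner ℝ (secondaryOperator hρ hμ f) (secondaryToL2 hρ hμ p) =
      ∫ x, secondaryFun I ρ p x ∂densityMeasure I ρ := by
  have h1 : ∀ᵐ x ∂densityMeasure I μ,
      inner ℝ (secondaryOperator hρ hμ f x) (secondaryToL2 hρ hμ p x) =
        ρ x / μ x * secondaryFun I ρ p x := by
    filter_upwards [hf, (memLp_secondaryFun hρ hμ p).coeFn_toLp] with x h1 h2
    have h2' : secondaryToL2 hρ hμ p x = secondaryFun I ρ p x := h2
    rw [h1, h2']
    exact mul_comm _ _
  rw [L2.inner_def, integral_congr_ae h1, hμ.integral_densityMeasure, hρ.integral_densityMeasure]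
  refine integral_congr_ae ?_
  filter_upwards [h0, hρ.nonneg] with x h2 h3
  rcases le_or_gt (μ x) 0 with h4 | h4
  -- Where `μ ≤ 0`, the density `ρ` is zero and both integrands vanish.
  · simp [le_antisymm (h2 h4) h3]
  · simp only [smul_eq_mul]
    field_simp

/-- The reducer is the orthogonal projection onto the hyperplane of any antecedent `f`; subtracting
a constant does not change the image because `T_ρ` kills constants. -/
theorem IsReducible.isAntecedent_reducerL2 {hρ : IsMomentDensity I ρ}
    {hμ : IsSecondaryDensity I ρ μ} (h : IsReducible hρ hμ.isMomentDensity)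
    (hρ1 : ∫ x in I, ρ x = 1) (hdense : DenseRange (polyToL2 hρ))
    (h0 : ∀ᵐ x ∂(volume.restrict I), μ x ≤ 0 → ρ x ≤ 0) :
    IsAntecedent hρ hμ.isMomentDensity h.reducerL2 := by
  obtain ⟨f, hf⟩ := h.exists_antecedent
  have hT := secondaryOperator_polyToL2 hρ hμ hρ1 hdense
  have h1 : h.reducerL2 = f - inner ℝ (polyToL2 hρ 1) f • polyToL2 hρ 1 := by
    refine hdense.eq_of_inner_left ℝ fun p => ?_
    rw [h.inner_reducerL2, ← hf.inner_secondaryToL2 h0, ← hT,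
      inner_secondaryOperator hρ hμ hρ1 hdense, inner_sub_left, real_inner_smul_left]
  have h2 : secondaryOperator hρ hμ.isMomentDensity (polyToL2 hρ 1) = 0 := by
    have h3 := inner_secondaryOperator hρ hμ hρ1 hdense (polyToL2 hρ 1) (polyToL2 hρ 1)
    rw [inner_polyToL2_polyToL2] at h3
    simp only [mul_one, eval_one, one_mul, hρ1, sub_self] at h3
    exact inner_self_eq_zero.mp h3
  rw [IsAntecedent, h1, map_sub, map_smul, h2, smul_zero, sub_zero]
  exact hf

end SecondaryMeasure

end

theorem mainTheorem1 (I : Set ℝ) (hI : I.OrdConnected) (ρ μ : ℝ → ℝ)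
    (hρ : SecondaryMeasure.IsMomentDensity I ρ)
    (hρ_cont : ContinuousOn ρ (interior I))
    (hρ_prob : ∫ x in I, ρ x = 1)
    (hρ_dense : DenseRange (SecondaryMeasure.polyToL2 hρ))
    (hμ : SecondaryMeasure.IsSecondaryDensity I ρ μ)
    (hφ : ∀ᵐ x ∂(volume.restrict I), ∃ l : ℝ,
      Tendsto (fun ε => SecondaryMeasure.approxReducer I ρ ε x) (𝓝[>] (0 : ℝ)) (𝓝 l))
    (hred : SecondaryMeasure.IsReducible hρ hμ.isMomentDensity) :
    -- `T_ρ` does extend the operator creating secondary polynomials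
    (∀ p : ℝ[X], SecondaryMeasure.secondaryOperator hρ hμ.isMomentDensity
        (SecondaryMeasure.polyToL2 hρ p) =
      SecondaryMeasure.secondaryToL2 hρ hμ.isMomentDensity p) ∧
    -- `ρ / μ` has exactly one antecedent in the hyperplane, and it is the reducer
    (∃! ψ : Lp ℝ 2 (SecondaryMeasure.densityMeasure I ρ),
      ψ ∈ SecondaryMeasure.hyperplane hρ ∧
        SecondaryMeasure.IsAntecedent hρ hμ.isMomentDensity ψ) ∧
    hred.reducerL2 ∈ SecondaryMeasure.hyperplane hρ ∧
    SecondaryMeasure.IsAntecedent hρ hμ.isMomentDensity hred.reducerL2 := by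
  have h0 := hμ.ae_nonpos_of_nonpos hρ hI.measurableSet hφ
  have hmem := hred.reducerL2_mem_hyperplane
  have hante := hred.isAntecedent_reducerL2 (hμ := hμ) hρ_prob hρ_dense h0
  refine ⟨SecondaryMeasure.secondaryOperator_polyToL2 hρ hμ hρ_prob hρ_dense,
    ⟨hred.reducerL2, ⟨hmem, hante⟩, fun ψ hψ => ?_⟩, hmem, hante⟩
  refine SecondaryMeasure.eq_of_secondaryOperator_eq hρ hμ hρ_prob hρ_dense hψ.1 hmem ?_
  exact Lp.ext (hψ.2.trans hante.symm)
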